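/- Let $\mathcal{C}$ be an abelian category. An allowable class $E$ in $\mathcal{C}$ is a collection of short exact sequences in $\mathcal{C}$ which is closed under isomorphism of short exact sequences and contains every short exact sequence in which at least one object is zero. A monomorphism $f\colon M\to N$ is an $E$-monomorphism (or $E$-monic) if $0\to M\xrightarrow{f} N\to\operatorname{coker} f\to 0$ is in $E$; dually, an epimorphism $f\colon M\to N$ is an $E$-epimorphism (or $E$-epic) if $0\to\ker f\to M\xrightarrow{f} N\to 0$ is in $E$. An object is $E$-projective if maps out of it lift over every $E$-epimorphism, and $E$-injective if maps into it extend along every $E$-monomorphism. $\mathcal{C}$ has enough $E$-projectives if every object $X$ admits an $E$-epimorphism $P\to X$ with $P$ $E$-projective, and enough $E$-injectives if every object $X$ admits an $E$-monomorphism $X\to I$ with $I$ $E$-injective. $E$ has sectile epics if $g$ is an $E$-epic whenever $g\circ f$ is, and retractile monics if $f$ is an $E$-monic whenever $g\circ f$ is. Morphisms $f,g\colon M\to N$ are $E$-stably equivalent, $f\simeq g$, if $f-g$ factors through an $E$-projective object; a morphism $f\colon M\to N$ is an $E$-stable equivalence if there is $h\colon N\to M$ with $f\circ h\simeq \mathrm{id}_N$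 and $h\circ f\simeq\mathrm{id}_M$. A weak Waldhausen abelian category is an abelian category $\mathcal{C}$ with two subcategories $\mathrm{cof}(\mathcal{C})$ and $\mathrm{we}(\mathcal{C})$, each containing all identity morphisms, such that for some allowable class $E$ in $\mathcal{C}$ (then called allowable for $\mathcal{C}$) $\mathrm{we}(\mathcal{C})$ is the class of $E$-stable equivalences and $\mathrm{cof}(\mathcal{C})$ is the class of $E$-monomorphisms. For a category $\mathcal{D}$, a $\mathcal{D}$-indexed homotopy colimit diagram in $\mathcal{C}$ is a functor $F\colon\mathcal{D}\to\mathcal{C}$ such that $0\to F(X)$ is in $\mathrm{cof}(\mathcal{C})$ for every object $X$ of $\mathcal{D}$ and $F(f)$ is in $\mathrm{cof}(\mathcal{C})$ for every morphism $f$ of $\mathcal{D}$. If $\mathcal{C}$ has all $\mathcal{D}$-indexed colimits, then $\mathcal{D}$-indexed homotopy colimits are well-defined in $\mathcal{C}$ if, for all $\mathcal{D}$-indexed homotopy colimit diagrams $F,G$ and every natural transformation $\phi\colon F\to G$ such that $\phi(X)\in\mathrm{we}(\mathcal{C})$ for every object $X$ of $\mathcal{D}$, the induced map $\operatorname{colim}F\to\operatorname{colim}G$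 is in $\mathrm{we}(\mathcal{C})$. Homotopy pushouts are well-defined if this holds for $\mathcal{D}=(\bullet\leftarrow\bullet\rightarrow\bullet)$. **Proposition.** Let $\mathcal{C}$ be a weak Waldhausen abelian category and let $E$ be an allowable class that is allowable for $\mathcal{C}$. Suppose that $\mathcal{C}$ has enough $E$-projectives and enough $E$-injectives, that $E$ has sectile epics and retractile monics, and that every $E$-projective object is $E$-injective. Then homotopy pushouts are well-defined in $\mathcal{C}$. -/

import Mathlib

open CategoryTheory CategoryTheory.Limits

universe w w' v u

namespace RelHomAlg

/-! ### Relative homological algebra -/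

/-- An allowable class in an abelian category: a collection of short exact sequences which is
closed under isomorphism of short exact sequences and which contains every short exact sequence in
which at least one of the three objects is a zero object. -/
structure AllowableClass (C : Type u) [Category.{v} C] [Abelian C] where
  /-- membership of a sequence `X₁ ⟶ X₂ ⟶ X₃` in the class -/
  Mem : ShortComplex C → Prop
  shortExact : ∀ S : ShortComplex C, Mem S → S.ShortExact
  of_iso : ∀ S T : ShortComplex C, Nonempty (S ≅ T) → Mem S → Mem T
  of_isZero : ∀ S : ShortComplex C, S.ShortExact →
    (IsZero S.X₁ ∨ IsZero S.X₂ ∨ IsZero S.X₃) → Mem S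

namespace AllowableClass

variable {C : Type u} [Category.{v} C] [Abelian C] (E : AllowableClass C)

/-- The `E`-monomorphisms: the monomorphisms `f : M ⟶ N` such that
`0 ⟶ M ⟶ N ⟶ coker f ⟶ 0` is in `E`. -/
def monics : MorphismProperty C := fun _ _ f =>
  Mono f ∧ E.Mem (ShortComplex.mk f (cokernel.π f) (cokernel.condition f))

/-- The `E`-epimorphisms: the epimorphisms `f : M ⟶ N` such that
`0 ⟶ ker f ⟶ M ⟶ N ⟶ 0` is in `E`. -/
def epics : MorphismProperty C := fun _ _ f =>
  Epi f ∧ E.Mem (ShortComplex.mk (kernel.ι f) f (kernel.condition f))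

/-- `E`-projective objects: maps out of `P` lift over every `E`-epimorphism. -/
def IsProjective (P : C) : Prop :=
  ∀ (M N : C) (f : M ⟶ N), E.epics f → ∀ g : P ⟶ N, ∃ h : P ⟶ M, h ≫ f = g

/-- `E`-injective objects: maps into `I` extend along every `E`-monomorphism. -/
def IsInjective (I : C) : Prop :=
  ∀ (M N : C) (f : M ⟶ N), E.monics f → ∀ g : M ⟶ I, ∃ h : N ⟶ I, f ≫ h = g

/-- Every object receives an `E`-epimorphism from an `E`-projective object. -/
def EnoughProjectives : Prop :=
  ∀ X : C, ∃ (P : C) (p : P ⟶ X), E.IsProjective P ∧ E.epics p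

/-- Every object admits an `E`-monomorphism to an `E`-injective object. -/
def EnoughInjectives : Prop :=
  ∀ X : C, ∃ (I : C) (i : X ⟶ I), E.IsInjective I ∧ E.monics i

/-- `E` has retractile monics: whenever `g ∘ f` is an `E`-monic, so is `f`. -/
def HasRetractileMonics : Prop :=
  ∀ (X Y Z : C) (f : X ⟶ Y) (g : Y ⟶ Z), E.monics (f ≫ g) → E.monics f

/-- `E` has sectile epics: whenever `g ∘ f` is an `E`-epic, so is `g`. -/
def HasSectileEpics : Prop :=
  ∀ (X Y Z : C) (f : X ⟶ Y) (g : Y ⟶ Z), E.epics (f ≫ g) → E.epics g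

/-- Two parallel morphisms are `E`-stably equivalent if their difference factors through an
`E`-projective object. -/
def StablyEquivalent {M N : C} (f g : M ⟶ N) : Prop :=
  ∃ (P : C) (a : M ⟶ P) (b : P ⟶ N), E.IsProjective P ∧ a ≫ b = f - g

/-- The `E`-stable equivalences: the morphisms which are invertible up to `E`-stable equivalence
of morphisms. -/
def stableEquivalences : MorphismProperty C := fun M N f =>
  ∃ h : N ⟶ M, E.StablyEquivalent (h ≫ f) (𝟙 N) ∧ E.StablyEquivalent (f ≫ h) (𝟙 M)

end AllowableClass

/-! ### Weak Waldhausen categories and homotopy colimits -/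

/-- The structure of a weak Waldhausen category on `C`: two subcategories (of cofibrations and of
weak equivalences), each of which contains all the identity morphisms. -/
structure WeakWaldhausenStructure (C : Type u) [Category.{v} C] where
  /-- the cofibrations -/
  cof : MorphismProperty C
  /-- the weak equivalences -/
  we : MorphismProperty C
  cof_id : ∀ X : C, cof (𝟙 X)
  cof_comp : ∀ (X Y Z : C) (f : X ⟶ Y) (g : Y ⟶ Z), cof f → cof g → cof (f ≫ g)
  we_id : ∀ X : C, we (𝟙 X)
  we_comp : ∀ (X Y Z : C) (f : X ⟶ Y) (g : Y ⟶ Z), we f → we g → we (f ≫ g)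

/-- The allowable class `E` is allowable for the weak Waldhausen structure `W`: the weak
equivalences are the `E`-stable equivalences and the cofibrations are the `E`-monomorphisms. -/
def AllowableClass.IsAllowableFor {C : Type u} [Category.{v} C] [Abelian C]
    (E : AllowableClass C) (W : WeakWaldhausenStructure C) : Prop :=
  W.we = E.stableEquivalences ∧ W.cof = E.monics

/-- A weak Waldhausen abelian category structure on an abelian category: a weak Waldhausen
structure for which there exists an allowable class. -/
structure WeakWaldhausenAbelianStructure (C : Type u) [Category.{v} C] [Abelian C] extends
    WeakWaldhausenStructure C where
  exists_allowable : ∃ E : AllowableClass C, E.IsAllowableFor toWeakWaldhausenStructure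

namespace WeakWaldhausenStructure

variable {C : Type u} [Category.{v} C] (W : WeakWaldhausenStructure C)

/-- A `D`-indexed homotopy colimit diagram: a functor all of whose values are cofibrant and which
sends every morphism to a cofibration. -/
structure IsHomotopyColimitDiagram [HasInitial C] {D : Type w} [Category.{w'} D]
    (F : D ⥤ C) : Prop where
  cof_initial : ∀ d : D, W.cof (initial.to (F.obj d))
  cof_map : ∀ (d e : D) (f : d ⟶ e), W.cof (F.map f)

/-- `D`-indexed homotopy colimits are well-defined: a map of `D`-indexed homotopy colimit diagrams
which is levelwise a weak equivalence induces a weak equivalence on colimits. -/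
def HomotopyColimitsWellDefined [HasInitial C] (D : Type w) [Category.{w'} D]
    [HasColimitsOfShape D C] : Prop :=
  ∀ (F G : D ⥤ C), W.IsHomotopyColimitDiagram F → W.IsHomotopyColimitDiagram G →
    ∀ φ : F ⟶ G, (∀ d : D, W.we (φ.app d)) → W.we (colimMap φ)

/-- Homotopy pushouts are well-defined: the case of the indexing category `• ⟵ • ⟶ •`. -/
def HomotopyPushoutsWellDefined [HasInitial C] [HasPushouts C] : Prop :=
  W.HomotopyColimitsWellDefined WalkingSpan

end WeakWaldhausenStructure

end RelHomAlg

/-!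
Call a morphism negligible if it factors through an `E`-projective object. Negligible morphisms
form an ideal, and a stable equivalence is a morphism that is invertible modulo this ideal.

The pushout of a span `B ⟵ A ⟶ B'` of `E`-monics is the cokernel of `A ⟶ B ⊞ B'`, which is an
`E`-monic because `E` has retractile monics. It therefore suffices to show that, in a map of
sequences from `A ⟶ X ⟶ D` to `A' ⟶ X' ⟶ D'`, where the second morphism of each sequence is the
cokernel of an `E`-monic, the component `D ⟶ D'` is a stable equivalence as soon as the other two
are (`stableEquivalences_of_cokernels`). This rests on the fact that a negligible morphism
`A ⟶ Y` extends to a negligible morphism `X ⟶ Y` along an `E`-monic `A ⟶ X`, as `E`-projectives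
are `E`-injective.

* Stable inverses `A' ⟶ A` and `X' ⟶ X` commute with `A ⟶ X` and `A' ⟶ X'` up to a negligible
  morphism `A' ⟶ X`. Extending it over `X'` and subtracting it from `X' ⟶ X` gives a square which
  commutes strictly, and hence an induced morphism `h : D' ⟶ D`.
* The two composites of `h` with `d : D ⟶ D'` differ from the identities by endomorphisms induced
  by negligible ones. Such an induced endomorphism has negligible square
  (`Negligible.sq_of_cokernel`), so `d` is invertible modulo negligible morphisms, with inverse
  `h (2 - d h)`.
-/

namespace RelHomAlg

namespace AllowableClass

variable {C : Type u} [Category.{v} C] [Abelian C] {E : AllowableClass C}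

variable (E) in
/-- A morphism is negligible if it factors through an `E`-projective object; equivalently, if it
is `E`-stably equivalent to zero. -/
def Negligible {M N : C} (f : M ⟶ N) : Prop :=
  ∃ (P : C) (a : M ⟶ P) (b : P ⟶ N), E.IsProjective P ∧ a ≫ b = f

lemma stablyEquivalent_iff {M N : C} (f g : M ⟶ N) :
    E.StablyEquivalent f g ↔ E.Negligible (f - g) := Iff.rfl

lemma IsProjective.biprod {P Q : C} (hP : E.IsProjective P) (hQ : E.IsProjective Q) :
    E.IsProjective (P ⊞ Q) := by
  intro M N f hf g
  obtain ⟨s, hs⟩ := hP M N f hf (biprod.inl ≫ g)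
  obtain ⟨t, ht⟩ := hQ M N f hf (biprod.inr ≫ g)
  exact ⟨biprod.desc s t, by ext <;> simp [hs, ht]⟩

namespace Negligible

lemma add {M N : C} {f g : M ⟶ N} (hf : E.Negligible f) (hg : E.Negligible g) :
    E.Negligible (f + g) := by
  obtain ⟨P, a, b, hP, rfl⟩ := hf
  obtain ⟨Q, c, d, hQ, rfl⟩ := hg
  exact ⟨P ⊞ Q, biprod.lift a c, biprod.desc b d, hP.biprod hQ, by simp⟩

lemma neg {M N : C} {f : M ⟶ N} (hf : E.Negligible f) : E.Negligible (-f) := by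
  obtain ⟨P, a, b, hP, rfl⟩ := hf
  exact ⟨P, a, -b, hP, by simp⟩

lemma sub {M N : C} {f g : M ⟶ N} (hf : E.Negligible f) (hg : E.Negligible g) :
    E.Negligible (f - g) := by
  simpa [sub_eq_add_neg] using hf.add hg.neg

lemma comp_left {L M N : C} {f : M ⟶ N} (hf : E.Negligible f) (g : L ⟶ M) :
    E.Negligible (g ≫ f) := by
  obtain ⟨P, a, b, hP, rfl⟩ := hf
  exact ⟨P, g ≫ a, b, hP, by simp⟩

lemma comp_right {L M N : C} {f : L ⟶ M} (hf : E.Negligible f) (g : M ⟶ N) :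
    E.Negligible (f ≫ g) := by
  obtain ⟨P, a, b, hP, rfl⟩ := hf
  exact ⟨P, a, b ≫ g, hP, by simp⟩

lemma exists_extension (hE : ∀ P : C, E.IsProjective P → E.IsInjective P)
    {A X Y : C} {f : A ⟶ Y} (hf : E.Negligible f) {i : A ⟶ X} (hi : E.monics i) :
    ∃ g : X ⟶ Y, i ≫ g = f ∧ E.Negligible g := by
  obtain ⟨P, a, b, hP, rfl⟩ := hf
  obtain ⟨s, rfl⟩ := hE P hP A X i hi a
  exact ⟨s ≫ b, by simp, P, s, b, hP, rfl⟩

/-- The endomorphism induced on the cokernel of an `E`-monic by negligible endomorphisms need not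
be negligible, but its square is: `n` factors as `D ⟶ X ⟶ D`, and `n ≫ n` therefore factors through
the given negligible endomorphism of `X`. -/
lemma sq_of_cokernel (hE : ∀ P : C, E.IsProjective P → E.IsInjective P)
    {A X D : C} {i : A ⟶ X} {p : X ⟶ D} (hi : E.monics i) (w : i ≫ p = 0)
    (hp : IsColimit (CokernelCofork.ofπ p w))
    {α : A ⟶ A} {ξ : X ⟶ X} {n : D ⟶ D} (hiα : i ≫ ξ = α ≫ i) (hpn : p ≫ n = ξ ≫ p)
    (hα : E.Negligible α) (hξ : E.Negligible ξ) : E.Negligible (n ≫ n) := by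
  -- Only that `α` extends over `X` matters here, not that the extension is negligible.
  obtain ⟨β, hβ, -⟩ := hα.exists_extension hE hi
  obtain ⟨t, ht⟩ := CokernelCofork.IsColimit.desc' hp (ξ - β ≫ i)
    (by simp [hiα, reassoc_of% hβ])
  replace ht : p ≫ t = ξ - β ≫ i := ht
  have : Epi p := Cofork.IsColimit.epi hp
  have hn : n = t ≫ p := by
    rw [← cancel_epi p, reassoc_of% ht, hpn]
    simp [w]
  have hnn : n ≫ n = t ≫ ξ ≫ p := by
    conv_lhs => rw [hn, Category.assoc, ← hn, hpn]
  exact hnn ▸ (hξ.comp_right p).comp_left t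

end Negligible

/-- It is enough to invert a morphism up to endomorphisms with negligible square. -/
lemma stableEquivalences_of_sq {M N : C} (d : M ⟶ N) (h : N ⟶ M)
    (hN : E.Negligible ((h ≫ d - 𝟙 N) ≫ (h ≫ d - 𝟙 N)))
    (hM : E.Negligible ((d ≫ h - 𝟙 M) ≫ (d ≫ h - 𝟙 M))) : E.stableEquivalences d := by
  -- If `e = 1 + n` and `n ^ 2` is negligible, then `2 - e = 1 - n` is inverse to `e` modulo
  -- negligible morphisms; this is applied to both composites of `h` and `d`.
  refine ⟨h + h - h ≫ d ≫ h, ?_, ?_⟩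
  · rw [stablyEquivalent_iff]
    convert hN.neg using 1
    simp only [Preadditive.add_comp, Preadditive.sub_comp, Preadditive.comp_sub, Category.assoc,
      Category.id_comp, Category.comp_id]
    abel
  · rw [stablyEquivalent_iff]
    convert hM.neg using 1
    simp only [Preadditive.comp_add, Preadditive.sub_comp, Preadditive.comp_sub, Category.assoc,
      Category.id_comp, Category.comp_id]
    abel

/-- In a map between sequences consisting of an `E`-monic and its cokernel, if the first two
components are stable equivalences, then so is the third. -/
lemma stableEquivalences_of_cokernels (hE : ∀ P : C, E.IsProjective P → E.IsInjective P)
    {A X D A' X' D' : C} {i : A ⟶ X} {p : X ⟶ D} {i' : A' ⟶ X'} {p' : X' ⟶ D'}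
    (hi : E.monics i) (hi' : E.monics i') (w : i ≫ p = 0) (w' : i' ≫ p' = 0)
    (hp : IsColimit (CokernelCofork.ofπ p w)) (hp' : IsColimit (CokernelCofork.ofπ p' w'))
    {a : A ⟶ A'} {x : X ⟶ X'} {d : D ⟶ D'} (hix : i ≫ x = a ≫ i') (hpd : p ≫ d = x ≫ p')
    (ha : E.stableEquivalences a) (hx : E.stableEquivalences x) : E.stableEquivalences d := by
  obtain ⟨k, hk, hk'⟩ := ha
  obtain ⟨l₀, hl₀, hl₀'⟩ := hx
  rw [stablyEquivalent_iff] at hk hk' hl₀ hl₀'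
  -- Rectify `l₀` to a stable inverse of `x` which commutes strictly with `k`.
  -- Modulo negligible morphisms, `i' ≫ l₀ = k ≫ a ≫ i' ≫ l₀ = k ≫ i ≫ x ≫ l₀ = k ≫ i`.
  have hδ : E.Negligible (i' ≫ l₀ - k ≫ i) := by
    convert (hl₀'.comp_left (k ≫ i)).sub (hk.comp_right (i' ≫ l₀)) using 1
    simp [reassoc_of% hix]
  obtain ⟨s, hs, hsn⟩ := hδ.exists_extension hE hi'
  obtain ⟨l, hl⟩ : ∃ l, l = l₀ - s := ⟨_, rfl⟩
  have hil : i' ≫ l = k ≫ i := by simp [hl, hs]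
  have hlx : E.Negligible (l ≫ x - 𝟙 X') := by
    convert hl₀.sub (hsn.comp_right x) using 1
    simp only [hl, Preadditive.sub_comp]
    abel
  have hxl : E.Negligible (x ≫ l - 𝟙 X) := by
    convert hl₀'.sub (hsn.comp_left x) using 1
    simp only [hl, Preadditive.comp_sub]
    abel
  obtain ⟨h, hh⟩ := CokernelCofork.IsColimit.desc' hp' (l ≫ p)
    (by rw [reassoc_of% hil, w, comp_zero])
  replace hh : p' ≫ h = l ≫ p := hh
  refine stableEquivalences_of_sq d h
    (Negligible.sq_of_cokernel hE hi' w' hp' (α := k ≫ a - 𝟙 A') (ξ := l ≫ x - 𝟙 X')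
      ?_ ?_ hk hlx)
    (Negligible.sq_of_cokernel hE hi w hp (α := a ≫ k - 𝟙 A) (ξ := x ≫ l - 𝟙 X)
      ?_ ?_ hk' hxl)
  · simp [reassoc_of% hil, hix]
  · simp [reassoc_of% hh, hpd]
  · simp [reassoc_of% hix, hil]
  · simp [reassoc_of% hpd, hh]

lemma stableEquivalences.biprod_map {M N M' N' : C} {f : M ⟶ N} {g : M' ⟶ N'}
    (hf : E.stableEquivalences f) (hg : E.stableEquivalences g) :
    E.stableEquivalences (biprod.map f g) := by
  obtain ⟨h, hh, hh'⟩ := hf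
  obtain ⟨k, hk, hk'⟩ := hg
  rw [stablyEquivalent_iff] at hh hh' hk hk'
  -- A block diagonal endomorphism is negligible if its blocks are.
  have key {X Y : C} {s : X ⟶ X} {t : Y ⟶ Y} (hs : E.Negligible (s - 𝟙 X))
      (ht : E.Negligible (t - 𝟙 Y)) : E.Negligible (biprod.map s t - 𝟙 (X ⊞ Y)) := by
    convert ((hs.comp_right biprod.inl).comp_left biprod.fst).add
      ((ht.comp_right biprod.inr).comp_left biprod.snd) using 1
    ext <;> simp
  refine ⟨biprod.map h k, ?_, ?_⟩
  · rw [stablyEquivalent_iff]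
    convert key hh hk using 2
    ext <;> simp
  · rw [stablyEquivalent_iff]
    convert key hh' hk' using 2
    ext <;> simp

lemma monics_lift (hE : E.HasRetractileMonics) {A B B' : C} {f : A ⟶ B} (g : A ⟶ B')
    (hf : E.monics f) : E.monics (biprod.lift f g) :=
  hE _ _ _ _ biprod.fst (by simpa using hf)

end AllowableClass

end RelHomAlg

theorem mainTheorem3 {C : Type u} [CategoryTheory.Category.{v} C] [CategoryTheory.Abelian C]
    (W : RelHomAlg.WeakWaldhausenAbelianStructure C)
    (E : RelHomAlg.AllowableClass C)
    (hE : E.IsAllowableFor W.toWeakWaldhausenStructure)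
    (hproj : E.EnoughProjectives)
    (hinj : E.EnoughInjectives)
    (hsectile : E.HasSectileEpics)
    (hretractile : E.HasRetractileMonics)
    (hprojinj : ∀ P : C, E.IsProjective P → E.IsInjective P) :
    W.toWeakWaldhausenStructure.HomotopyPushoutsWellDefined := by
  intro F G hF hG φ hφ
  obtain ⟨hwe, hcof⟩ := hE
  have hFm := hcof ▸ hF.cof_map _ _ WalkingSpan.Hom.fst
  have hGm := hcof ▸ hG.cof_map _ _ WalkingSpan.Hom.fst
  rw [hwe] at hφ ⊢
  have sqF := IsPushout.of_isColimit_cocone (colimit.isColimit F)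
  have sqG := IsPushout.of_isColimit_cocone (colimit.isColimit G)
  refine RelHomAlg.AllowableClass.stableEquivalences_of_cokernels hprojinj
    (RelHomAlg.AllowableClass.monics_lift hretractile _ hFm)
    (RelHomAlg.AllowableClass.monics_lift hretractile _ hGm) _ _
    sqF.isColimitCokernelCofork sqG.isColimitCokernelCofork
    (a := φ.app WalkingSpan.zero)
    (x := biprod.map (φ.app WalkingSpan.left) (φ.app WalkingSpan.right)) ?_ ?_ (hφ _)
    ((hφ _).biprod_map (hφ _))
  · ext <;> simp
  · ext <;> simp
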